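/- Let $X$ be a separable metric space and let $n\ge 0$ be an integer such that the topological (Lebesgue covering) dimension of $X$ is at most $n$; that is, every open cover of $X$ has an open refinement in which any $n+2$ pairwise distinct members have empty intersection. Let $G$ be a (discrete) group acting on $X$ by isometries such that every orbit $G\cdot x$, $x\in X$, is a discrete subset of $X$. Call an open cover $\mathcal V$ of $X$ a $G$-invariant good open cover if $g\cdot V\in\mathcal V$ for all $g\in G$, $V\in\mathcal V$, and for every $V\in\mathcal V$ there is a point $x_V\in X$ such that for every $g\in G$ $$g\cdot V\cap V\neq\emptyset \iff g\cdot V=V \iff g\in G_{x_V},$$ where $G_{x}$ denotes the stabilizer of $x$. The nerve $\mathcal N(\mathcal V)$ is the simplicial complex whose vertices are the elements of $\mathcal V$ and in which finitely many pairwise distinct vertices span a simplex if and only if their intersection is non-empty; its geometric realization, with the weak topology, carries the simplicial $G$-action induced by $V\mapsto g\cdot V$. Then there is a $G$-invariant good open cover $\mathcal V$ of $X$ such that $Y=\mathcal N(\mathcal V)$, with its open simplices as open cells, is a $G$-CW-complex of dimension at most $n$, the stabilizer of every point of $Y$ is contained in the stabilizer $G_x$ of some point $x\in X$, and there is a continuous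 $G$-equivariant map $f\colon X\to Y$. -/

import Mathlib

open scoped Pointwise

universe u v

/-! ### Covering dimension -/

/-- `𝒰` is an open cover of the space `X`. -/
structure IsOpenCovering {X : Type u} [TopologicalSpace X] (𝒰 : Set (Set X)) : Prop where
  isOpen : ∀ U ∈ 𝒰, IsOpen U
  sUnion_eq : ⋃₀ 𝒰 = Set.univ

/-- The dimension of a cover: the infimum in `ℕ ∪ {∞}` of all `d` such that any `d + 2` pairwise
distinct members of the cover have empty intersection. -/
noncomputable def coverDim {X : Type u} (𝒰 : Set (Set X)) : ℕ∞ :=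
  ⨅ (d : ℕ) (_ : ∀ s : Finset (Set X), (s : Set (Set X)) ⊆ 𝒰 → s.card = d + 2 →
    ⋂₀ (s : Set (Set X)) = ∅), (d : ℕ∞)

/-- The (Lebesgue covering) topological dimension of `X`: the infimum in `ℕ ∪ {∞}` of all `d` such
that every open cover has an open refinement of dimension at most `d`. -/
noncomputable def topDim (X : Type u) [TopologicalSpace X] : ℕ∞ :=
  ⨅ (d : ℕ) (_ : ∀ 𝒰 : Set (Set X), IsOpenCovering 𝒰 →
    ∃ 𝒱 : Set (Set X), IsOpenCovering 𝒱 ∧ (∀ V ∈ 𝒱, ∃ U ∈ 𝒰, V ⊆ U) ∧ coverDim 𝒱 ≤ d), (d : ℕ∞)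

/-! ### Geometric realization of an abstract simplicial complex -/

/-- The geometric realization of an abstract simplicial complex `K`, given by barycentric
coordinates: finitely supported families of nonnegative reals of total mass one whose support is a
face of `K`. -/
@[ext]
structure Realization {ι : Type u} (K : PreAbstractSimplicialComplex ι) where
  weight : ι →₀ ℝ
  nonneg : ∀ i, 0 ≤ weight i
  sum_eq_one : ∑ i ∈ weight.support, weight i = 1
  support_mem : weight.support ∈ K.faces

namespace Realization

variable {ι : Type u} {K : PreAbstractSimplicialComplex ι}

/-- The closed simplex spanned by `s`. -/
def closedSimplex (K : PreAbstractSimplicialComplex ι) (s : Finset ι) : Set (Realization K) :=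
  {p | p.weight.support ⊆ s}

/-- The open simplex spanned by `s`. -/
def openSimplex (K : PreAbstractSimplicialComplex ι) (s : Finset ι) : Set (Realization K) :=
  {p | p.weight.support = s}

/-- The weak topology: every closed simplex carries its Euclidean topology (that of the barycentric
coordinates), and a set is open iff its intersection with each closed simplex is open there. -/
instance : TopologicalSpace (Realization K) :=
  ⨆ s : K.faces, TopologicalSpace.coinduced
    (Subtype.val : closedSimplex K s.1 → Realization K)
    (TopologicalSpace.induced (fun p (i : ι) => p.1.weight i) inferInstance)

end Realization

/-! ### `G`-CW-complexes for a discrete group `G` -/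

/-- A structure of `G`-CW-complex on a `G`-space `Y`, for a discrete group `G`: a Hausdorff
CW-structure on `Y` whose set of `n`-cells is a `G`-set for each `n`, with equivariant
characteristic maps `Φ (g • i) x = g • Φ i x`. Splitting the `G`-set of `n`-cells into orbits
`G ⧸ H`, this says precisely that `Y` is built by attaching equivariant cells `G ⧸ H × Dⁿ` along
`G`-maps `G ⧸ H × Sⁿ⁻¹ → Yₙ₋₁`. -/
structure GCWComplex (G : Type v) (Y : Type u) [Group G] [TopologicalSpace Y] [MulAction G Y] where
  t2Space : T2Space Y
  continuous_smul : ∀ g : G, Continuous fun y : Y => g • y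
  cw : Topology.CWComplex (Set.univ : Set Y)
  cellAction : ∀ n : ℕ, MulAction G (Topology.RelCWComplex.cell (Set.univ : Set Y) n)
  map_smul : ∀ (g : G) (n : ℕ) (i : Topology.RelCWComplex.cell (Set.univ : Set Y) n),
    ∀ x ∈ Metric.closedBall (0 : Fin n → ℝ) 1,
      Topology.RelCWComplex.map n (g • i) x = g • Topology.RelCWComplex.map n i x

namespace GCWComplex

variable {G : Type v} {Y : Type u} [Group G] [TopologicalSpace Y] [MulAction G Y]

/-- The `G`-CW-complex has no cells of dimension greater than `n`. -/
def DimLE (S : GCWComplex G Y) (n : ℕ) : Prop :=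
  ∀ m : ℕ, n < m → IsEmpty (S.cw.instRelCWComplex.cell m)

/-- The set of open `n`-cells, as subsets of `Y`. -/
def openCells (S : GCWComplex G Y) (n : ℕ) : Set (Set Y) :=
  letI := S.cw
  Set.range fun i : Topology.RelCWComplex.cell (Set.univ : Set Y) n =>
    Topology.RelCWComplex.openCell n i

end GCWComplex

/-! ### Good covers and their nerves -/

/-- The nerve of a family `𝒱` of subsets of `X`: the faces are the finite nonempty subfamilies with
nonempty intersection. -/
def nerve {X : Type u} (𝒱 : Set (Set X)) : PreAbstractSimplicialComplex (Set X) where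
  faces := {s | s.Nonempty ∧ (s : Set (Set X)) ⊆ 𝒱 ∧ (⋂₀ (s : Set (Set X))).Nonempty}
  isRelLowerSet_faces := by
    rintro s ⟨hs, hsub, hne⟩
    refine ⟨hs, fun t hts ht => ⟨ht, ?_, ?_⟩⟩
    · exact (Finset.coe_subset.2 hts).trans hsub
    · exact hne.mono (Set.sInter_subset_sInter (Finset.coe_subset.2 hts))

/-- A `G`-invariant good open cover of a `G`-space `X`. -/
structure GoodOpenCover (G : Type v) (X : Type u) [Group G] [TopologicalSpace X]
    [MulAction G X] where
  sets : Set (Set X)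
  isOpenCovering : IsOpenCovering sets
  smul_mem : ∀ (g : G), ∀ V ∈ sets, g • V ∈ sets
  good : ∀ V ∈ sets, ∃ x : X, ∀ g : G,
    ((g • V ∩ V).Nonempty ↔ g • V = V) ∧ (g • V = V ↔ g ∈ MulAction.stabilizer G x)

namespace GoodOpenCover

variable {G : Type v} {X : Type u} [Group G] [TopologicalSpace X] [MulAction G X]

/-- The geometric realization of the nerve of a good open cover. -/
abbrev Nerve (𝒱 : GoodOpenCover G X) : Type u := Realization (nerve 𝒱.sets)

/-- The simplicial action of `G` on the nerve induced by `V ↦ g • V` on vertices; in barycentric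
coordinates, `(g • p) V = p (g⁻¹ • V)`. -/
noncomputable instance (𝒱 : GoodOpenCover G X) : MulAction G 𝒱.Nerve where
  smul g p :=
    { weight := p.weight.equivMapDomain (MulAction.toPerm g)
      nonneg := fun V => by simpa using p.nonneg _
      sum_eq_one := by
        have h := p.sum_eq_one
        simpa [Finsupp.equivMapDomain] using h
      support_mem := by
        obtain ⟨h1, h2, x, hx⟩ := p.support_mem
        refine ⟨?_, ?_, g • x, ?_⟩
        · simpa [Finsupp.equivMapDomain] using h1
        · intro V hV
          simp only [Finsupp.equivMapDomain, Finset.coe_map, Set.mem_image] at hV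
          obtain ⟨W, hW, rfl⟩ := hV
          exact 𝒱.smul_mem g W (h2 hW)
        · intro V hV
          simp only [Finsupp.equivMapDomain, Finset.coe_map, Set.mem_image] at hV
          obtain ⟨W, hW, rfl⟩ := hV
          exact Set.smul_mem_smul_set (hx W hW) }
  one_smul p := by
    apply Realization.ext
    ext V
    change p.weight ((MulAction.toPerm (1 : G)).symm V) = p.weight V
    simp
  mul_smul g h p := by
    apply Realization.ext
    ext V
    change p.weight ((MulAction.toPerm (g * h)).symm V) =
      p.weight ((MulAction.toPerm h).symm ((MulAction.toPerm g).symm V))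
    simp [mul_smul]

end GoodOpenCover

/-!
The orbit space `X / G` carries the argument. Discrete orbits of an isometric action are closed, so
`X / G` is regular, and it is second countable, hence metrizable (`t3Space_quotient_orbitRel`).
Around each `x` a small ball is a slice: it is invariant under the stabilizer of `x` and disjoint
from its translates by all other elements. Suppose the images of these balls in `X / G` are refined
by an open cover `W` such that no point lies in more than `n + 1` of its members. Cutting the balls
down to the preimages of the members of `W` and taking all translates gives a good open cover of `X`
(`SliceFamily.toGoodOpenCover`). Two translates of the same slice are equal or disjoint, so the nerve
has dimension at most `n`. A partition of unity on `X / G` subordinate to `W` defines the equivariant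
map to the nerve: the weight of the translate containing a point is the value of the corresponding
function at its orbit (`SliceFamily.nerveMap`). Near a given point only finitely many slices matter,
whence continuity in the weak topology.

The existence of `W` says that passing to `X / G` does not raise the covering dimension
(`exists_refinement_quotient_orbitRel`). Countably many closed sets
`isolatedInOrbit G q r ⊆ X`, on each of which the orbit map is injective, have closed images covering
`X / G`, and the orbit map embeds each of them. On one such image a cover can be refined to order at
most `n + 1` using the dimension of `X` (`exists_refinement_on_isolatedInOrbit`). The argument of the
countable sum theorem then applies: successive shrinkings of a locally finite cover converge to a
closed cover of order at most `n + 1` (`exists_closed_refinement_of_forall_nat`), which is enlarged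
to an open one of the same order (`exists_open_swelling`).

Concerning the cell structure, no two vertices of a simplex of the nerve lie in the same `G`-orbit.
Hence a linear order on the set of orbits orders the vertices of all simplices compatibly with the
action, and the resulting characteristic maps are equivariant (`GoodOpenCover.nerveGCWComplex`). For
the same reason an element fixing a point of the nerve fixes every vertex of its carrier simplex.
-/

/-! ### Parametrizing the standard simplex by a cube -/

open Metric in
/-- The standard `d`-simplex is homeomorphic to the unit ball of `Fin d → ℝ`, the interior going to
the open ball. Dropping the coordinate `0` identifies it with a convex body, which is rescaled to the
ball by means of its gauge. -/
theorem exists_param_stdSimplex (d : ℕ) :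
    ∃ (φ : (Fin d → ℝ) → Fin (d + 1) → ℝ) (ψ : (Fin (d + 1) → ℝ) → Fin d → ℝ),
      (∀ z, φ z ∈ stdSimplex ℝ (Fin (d + 1))) ∧ ContinuousOn φ (closedBall 0 1) ∧ Continuous ψ ∧
      (∀ z ∈ closedBall 0 1, ψ (φ z) = z) ∧
      (∀ w ∈ stdSimplex ℝ (Fin (d + 1)), ψ w ∈ closedBall 0 1 ∧ φ (ψ w) = w) ∧
      (∀ w ∈ stdSimplex ℝ (Fin (d + 1)), ψ w ∈ ball 0 1 ↔ ∀ i, 0 < w i) := by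
  classical
  set S : Set (Fin d → ℝ) := {x | (∀ i, 0 ≤ x i) ∧ ∑ i, x i ≤ 1} with hS
  set O : Set (Fin d → ℝ) := {x | (∀ i, 0 < x i) ∧ ∑ i, x i < 1} with hO
  have hSconv : Convex ℝ S := by
    rw [hS, Set.ofPred_and]
    refine Convex.inter ?_ ?_
    · rw [Set.ofPred_forall]
      exact convex_iInter fun i => convex_halfSpace_ge (LinearMap.isLinear (LinearMap.proj i)) 0
    · exact convex_halfSpace_le
        ⟨fun x y => by simp [Finset.sum_add_distrib], fun c x => by simp [Finset.mul_sum]⟩ 1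
  have hSclosed : IsClosed S := by
    rw [hS, Set.ofPred_and, Set.ofPred_forall]
    exact (isClosed_iInter fun i => isClosed_le continuous_const (continuous_apply i)).inter
      (isClosed_le (by fun_prop) continuous_const)
  have hOopen : IsOpen O := by
    rw [hO, Set.ofPred_and, Set.ofPred_forall]
    exact (isOpen_iInter_of_finite fun i => isOpen_lt continuous_const (continuous_apply i)).inter
      (isOpen_lt (by fun_prop) continuous_const)
  have hint : interior S = O := by
    refine Set.Subset.antisymm ?_ (interior_maximal ?_ hOopen)
    · intro x hx
      have hx' := mem_interior_iff_mem_nhds.1 hx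
      have key : ∀ v : Fin d → ℝ, ∃ t : ℝ, 0 < t ∧ x + t • v ∈ S := by
        intro v
        have hc : Filter.Tendsto (fun t : ℝ => x + t • v) (nhds 0) (nhds x) := by
          have : Continuous fun t : ℝ => x + t • v := by fun_prop
          simpa using this.tendsto 0
        have h1 : ∀ᶠ t : ℝ in nhdsWithin 0 (Set.Ioi 0), x + t • v ∈ S :=
          (hc.eventually hx').filter_mono nhdsWithin_le_nhds
        obtain ⟨t, ht, ht'⟩ := (h1.and self_mem_nhdsWithin).exists
        exact ⟨t, ht', ht⟩
      have hpos : ∀ i, 0 < x i := by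
        intro i
        obtain ⟨t, ht, h⟩ := key (-Pi.single i 1)
        have := h.1 i
        simp at this
        linarith
      refine ⟨hpos, ?_⟩
      by_contra! hge
      obtain ⟨t, ht, h⟩ := key x
      have h2 := h.2
      simp only [Pi.add_apply, Pi.smul_apply, smul_eq_mul, Finset.sum_add_distrib,
        ← Finset.mul_sum] at h2
      nlinarith
    · exact fun x hx => ⟨fun i => (hx.1 i).le, hx.2.le⟩
  have hne : (interior S).Nonempty := by
    rw [hint]
    refine ⟨fun _ => 1 / (d + 1), fun i => by positivity, ?_⟩
    rw [Finset.sum_const, Finset.card_univ, Fintype.card_fin, nsmul_eq_mul, mul_one_div,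
      div_lt_one (by positivity)]
    linarith
  have hb : Bornology.IsBounded S := by
    refine (isBounded_closedBall (x := (0 : Fin d → ℝ)) (r := 1)).subset fun x hx => ?_
    rw [mem_closedBall_zero_iff, pi_norm_le_iff_of_nonneg zero_le_one]
    intro i
    rw [Real.norm_of_nonneg (hx.1 i)]
    exact (Finset.single_le_sum (fun j _ => hx.1 j) (Finset.mem_univ i)).trans hx.2
  obtain ⟨h, hi, hc, -⟩ :=
    exists_homeomorph_image_interior_closure_frontier_eq_unitBall hSconv hne hb
  rw [hint] at hi
  rw [hSclosed.closure_eq] at hc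
  have hcS : ∀ z, z ∈ closedBall (0 : Fin d → ℝ) 1 → h.symm z ∈ S := by
    intro z hz
    rw [← hc] at hz
    obtain ⟨y, hy, rfl⟩ := hz
    simpa using hy
  have htail : ∀ w ∈ stdSimplex ℝ (Fin (d + 1)), (fun i : Fin d => w i.succ) ∈ S ∧
      w 0 = 1 - ∑ i : Fin d, w i.succ := by
    intro w hw
    have hs := hw.2
    rw [Fin.sum_univ_succ] at hs
    have := hw.1 0
    exact ⟨⟨fun i => hw.1 _, by linarith⟩, by linarith⟩
  have hψ : ∀ w ∈ stdSimplex ℝ (Fin (d + 1)),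
      h (fun i => w i.succ) ∈ closedBall (0 : Fin d → ℝ) 1 := by
    intro w hw
    rw [← hc]
    exact ⟨_, (htail w hw).1, rfl⟩
  -- Outside the ball, `c` substitutes the centre, so that the parametrization has values in the
  -- simplex everywhere.
  let c : (Fin d → ℝ) → Fin d → ℝ := fun z => if z ∈ closedBall (0 : Fin d → ℝ) 1 then z else 0
  have hcm : ∀ z, c z ∈ closedBall (0 : Fin d → ℝ) 1 := by
    intro z
    by_cases hz : z ∈ closedBall (0 : Fin d → ℝ) 1
    · simpa only [c, if_pos hz] using hz
    · simp only [c, if_neg hz]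
      exact mem_closedBall_self zero_le_one
  have hce : ∀ z ∈ closedBall (0 : Fin d → ℝ) 1, c z = z := fun z hz => if_pos hz
  refine ⟨fun z => Fin.cons (1 - ∑ i, h.symm (c z) i) (h.symm (c z)),
    fun w => h fun i => w i.succ, ?_, ?_, ?_, ?_, ?_, ?_⟩
  · intro z
    have := hcS _ (hcm z)
    refine ⟨fun i => ?_, ?_⟩
    · refine Fin.cases ?_ (fun j => ?_) i
      · simpa using this.2
      · simpa using this.1 j
    · rw [Fin.sum_univ_succ]
      simp
  · have : Continuous fun z : Fin d → ℝ =>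
        (Fin.cons (1 - ∑ i, h.symm z i) (h.symm z) : Fin (d + 1) → ℝ) := by
      refine continuous_pi fun i => ?_
      refine Fin.cases ?_ (fun j => ?_) i
      · simp only [Fin.cons_zero]
        have := h.symm.continuous
        fun_prop
      · simp only [Fin.cons_succ]
        have := h.symm.continuous
        fun_prop
    refine this.continuousOn.congr fun z hz => ?_
    simp only [hce z hz]
  · exact h.continuous.comp (by fun_prop)
  · intro z hz
    simp [hce z hz]
  · intro w hw
    refine ⟨hψ w hw, ?_⟩
    funext i
    simp only [hce _ (hψ w hw), Homeomorph.symm_apply_apply]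
    refine Fin.cases ?_ (fun j => ?_) i
    · simp [(htail w hw).2]
    · simp
  · intro w hw
    have h1 : h (fun i => w i.succ) ∈ ball (0 : Fin d → ℝ) 1 ↔ (fun i : Fin d => w i.succ) ∈ O := by
      rw [← hi, h.injective.mem_set_image]
    rw [h1, Fin.forall_fin_succ, (htail w hw).2]
    constructor
    · exact fun hx => ⟨by linarith [hx.2], hx.1⟩
    · exact fun hx => ⟨hx.2, by linarith [hx.1]⟩

/-- A parametrization of the standard `d`-simplex by the cube `[-1, 1]ᵈ`, the closed unit ball of
`Fin d → ℝ`. Outside the cube it takes unspecified values in the simplex. -/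
noncomputable def cubeToSimplex (d : ℕ) : (Fin d → ℝ) → Fin (d + 1) → ℝ :=
  (exists_param_stdSimplex d).choose

/-- The inverse of `cubeToSimplex d` on the standard simplex, continuously extended to the ambient
space. -/
noncomputable def simplexToCube (d : ℕ) : (Fin (d + 1) → ℝ) → Fin d → ℝ :=
  (exists_param_stdSimplex d).choose_spec.choose

section Param

variable {d : ℕ}

theorem cubeToSimplex_mem (z : Fin d → ℝ) : cubeToSimplex d z ∈ stdSimplex ℝ (Fin (d + 1)) :=
  (exists_param_stdSimplex d).choose_spec.choose_spec.1 z

theorem continuousOn_cubeToSimplex : ContinuousOn (cubeToSimplex d) (Metric.closedBall 0 1) :=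
  (exists_param_stdSimplex d).choose_spec.choose_spec.2.1

theorem continuous_simplexToCube : Continuous (simplexToCube d) :=
  (exists_param_stdSimplex d).choose_spec.choose_spec.2.2.1

theorem simplexToCube_cubeToSimplex {z : Fin d → ℝ} (hz : z ∈ Metric.closedBall 0 1) :
    simplexToCube d (cubeToSimplex d z) = z :=
  (exists_param_stdSimplex d).choose_spec.choose_spec.2.2.2.1 z hz

theorem simplexToCube_mem_closedBall {w : Fin (d + 1) → ℝ}
    (hw : w ∈ stdSimplex ℝ (Fin (d + 1))) : simplexToCube d w ∈ Metric.closedBall 0 1 :=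
  ((exists_param_stdSimplex d).choose_spec.choose_spec.2.2.2.2.1 w hw).1

theorem cubeToSimplex_simplexToCube {w : Fin (d + 1) → ℝ}
    (hw : w ∈ stdSimplex ℝ (Fin (d + 1))) : cubeToSimplex d (simplexToCube d w) = w :=
  ((exists_param_stdSimplex d).choose_spec.choose_spec.2.2.2.2.1 w hw).2

theorem simplexToCube_mem_ball_iff {w : Fin (d + 1) → ℝ}
    (hw : w ∈ stdSimplex ℝ (Fin (d + 1))) :
    simplexToCube d w ∈ Metric.ball 0 1 ↔ ∀ i, 0 < w i :=
  (exists_param_stdSimplex d).choose_spec.choose_spec.2.2.2.2.2 w hw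

end Param

/-! ### The CW-structure on a geometric realization -/

namespace Realization

variable {ι : Type u} {K : PreAbstractSimplicialComplex ι}

theorem continuous_weight : Continuous fun (p : Realization K) (i : ι) => p.weight i := by
  refine continuous_iSup_dom.2 fun s => continuous_coinduced_dom.2 ?_
  exact continuous_induced_dom

theorem continuous_weight_apply (i : ι) : Continuous fun p : Realization K => p.weight i :=
  (continuous_apply i).comp continuous_weight

instance : T2Space (Realization K) :=
  T2Space.of_injective_continuous
    (fun _ _ h => Realization.ext (Finsupp.ext fun i => congrFun h i)) continuous_weight

/-- A map into a closed simplex is continuous for the weak topology as soon as its barycentric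
coordinates are. -/
theorem continuousOn_of_weight {Z : Type*} [TopologicalSpace Z] {f : Z → Realization K}
    {N : Set Z} {s : Finset ι} (hs : s ∈ K.faces) (hf : ∀ z ∈ N, f z ∈ closedSimplex K s)
    (hw : ∀ i, ContinuousOn (fun z => (f z).weight i) N) : ContinuousOn f N := by
  rw [continuousOn_iff_continuous_domRestrict]
  let _ : TopologicalSpace (closedSimplex K s) :=
    TopologicalSpace.induced (fun p (i : ι) => p.1.weight i) inferInstance
  have h1 : Continuous fun z : N => (⟨f z, hf z z.2⟩ : closedSimplex K s) := by
    refine continuous_induced_rng.2 (continuous_pi fun i => ?_)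
    exact (hw i).domRestrict
  have h2 : Continuous (Subtype.val : closedSimplex K s → Realization K) :=
    continuous_iSup_rng (i := ⟨s, hs⟩) continuous_coinduced_rng
  exact h2.comp h1

/-- A set is closed in the weak topology if its trace on every closed simplex is. -/
theorem isClosed_of_inter_closedSimplex {A : Set (Realization K)}
    (h : ∀ s ∈ K.faces, IsClosed (A ∩ closedSimplex K s)) : IsClosed A := by
  refine isClosed_iSup_iff.2 fun s => ?_
  let _ : TopologicalSpace (closedSimplex K s.1) :=
    TopologicalSpace.induced (fun p (i : ι) => p.1.weight i) inferInstance
  refine isClosed_coinduced.2 ?_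
  have h2 : Continuous (Subtype.val : closedSimplex K s.1 → Realization K) :=
    continuous_iSup_rng (i := s) continuous_coinduced_rng
  have := (h s.1 s.2).preimage h2
  rwa [show (Subtype.val : closedSimplex K s.1 → Realization K) ⁻¹' (A ∩ closedSimplex K s.1) =
    Subtype.val ⁻¹' A by ext p; exact and_iff_left p.2] at this

theorem openSimplex_subset_closedSimplex {s : Finset ι} :
    openSimplex K s ⊆ closedSimplex K s :=
  fun p (hp : p.weight.support = s) => Finset.subset_of_eq hp

theorem sum_weight_eq_one (p : Realization K) {s : Finset ι} (hp : p ∈ closedSimplex K s) :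
    ∑ i ∈ s, p.weight i = 1 := by
  rw [← p.sum_eq_one]
  exact (Finset.sum_subset hp fun i _ hi => by simpa using hi).symm

/-- The point of the realization with barycentric coordinates `w` with respect to a numbering `e`
of the vertices of the face `s`. -/
noncomputable def ofCoords {s : Finset ι} (hs : s ∈ K.faces) {d : ℕ} (e : s ≃ Fin (d + 1))
    (w : Fin (d + 1) → ℝ) (hw : w ∈ stdSimplex ℝ (Fin (d + 1))) : Realization K := by
  classical
  exact
  { weight := Finsupp.onFinset s (fun v => if h : v ∈ s then w (e ⟨v, h⟩) else 0)
      fun v hv => by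
        by_contra h
        simp [h] at hv
    nonneg := fun v => by
      rw [Finsupp.onFinset_apply]
      split_ifs
      exacts [hw.1 _, le_rfl]
    sum_eq_one := by
      rw [← hw.2, ← e.sum_comp w]
      rw [Finset.sum_subset (Finsupp.support_onFinset_subset) fun i _ hi => by simpa using hi,
        ← Finset.sum_coe_sort]
      exact Finset.sum_congr rfl fun v _ => by simp
    support_mem := by
      refine K.isRelLowerSet_faces.mem_of_le hs Finsupp.support_onFinset_subset ?_
      obtain ⟨i, -, hi⟩ : ∃ i ∈ Finset.univ, w i ≠ 0 :=
        Finset.exists_ne_zero_of_sum_ne_zero (by rw [hw.2]; exact one_ne_zero)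
      exact ⟨e.symm i, by simpa using hi⟩ }

section ofCoords

variable {s : Finset ι} {d : ℕ} {e : s ≃ Fin (d + 1)}
  {w : Fin (d + 1) → ℝ}

theorem ofCoords_weight_coe (hs : s ∈ K.faces) (hw : w ∈ stdSimplex ℝ (Fin (d + 1))) (v : s) :
    (ofCoords hs e w hw).weight v = w (e v) := by
  simp [ofCoords]

theorem ofCoords_weight_of_notMem (hs : s ∈ K.faces) (hw : w ∈ stdSimplex ℝ (Fin (d + 1)))
    {v : ι} (hv : v ∉ s) : (ofCoords hs e w hw).weight v = 0 := by
  simp [ofCoords, hv]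

theorem ofCoords_mem_closedSimplex (hs : s ∈ K.faces) (hw : w ∈ stdSimplex ℝ (Fin (d + 1))) :
    ofCoords hs e w hw ∈ closedSimplex K s := by
  intro v hv
  by_contra h
  exact Finsupp.mem_support_iff.1 hv (ofCoords_weight_of_notMem hs hw h)

theorem ofCoords_mem_openSimplex_iff (hs : s ∈ K.faces)
    (hw : w ∈ stdSimplex ℝ (Fin (d + 1))) :
    ofCoords hs e w hw ∈ openSimplex K s ↔ ∀ i, 0 < w i := by
  constructor
  · intro h i
    refine (hw.1 i).lt_of_ne' fun h0 => ?_
    have h1 : (e.symm i : ι) ∈ (ofCoords hs e w hw).weight.support := by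
      rw [show (ofCoords hs e w hw).weight.support = s from h]
      exact (e.symm i).2
    rw [Finsupp.mem_support_iff, ofCoords_weight_coe, e.apply_symm_apply] at h1
    exact h1 h0
  · intro h
    refine Finset.Subset.antisymm (ofCoords_mem_closedSimplex hs hw) fun v hv => ?_
    rw [Finsupp.mem_support_iff, ofCoords_weight_coe hs hw ⟨v, hv⟩]
    exact (h _).ne'

theorem coords_mem_stdSimplex (e : s ≃ Fin (d + 1)) {p : Realization K}
    (hp : p ∈ closedSimplex K s) :
    (fun i => p.weight (e.symm i)) ∈ stdSimplex ℝ (Fin (d + 1)) := by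
  refine ⟨fun i => p.nonneg _, ?_⟩
  rw [e.symm.sum_comp (fun v : s => p.weight v), Finset.sum_coe_sort s fun v => p.weight v]
  exact p.sum_weight_eq_one hp

theorem ofCoords_coords (hs : s ∈ K.faces) (e : s ≃ Fin (d + 1)) {p : Realization K}
    (hp : p ∈ closedSimplex K s) :
    ofCoords hs e (fun i => p.weight (e.symm i)) (coords_mem_stdSimplex e hp) = p := by
  refine Realization.ext (Finsupp.ext fun v => ?_)
  by_cases hv : v ∈ s
  · rw [ofCoords_weight_coe hs _ ⟨v, hv⟩, e.symm_apply_apply]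
  · rw [ofCoords_weight_of_notMem hs _ hv]
    exact (Finsupp.notMem_support_iff.1 fun h => hv (hp h)).symm

end ofCoords

section charMap

variable {s : Finset ι} {d : ℕ}

/-- The characteristic map of the cell belonging to the face `s`, for a numbering `e` of its
vertices. -/
noncomputable def charMap (hs : s ∈ K.faces) (e : s ≃ Fin (d + 1)) :
    PartialEquiv (Fin d → ℝ) (Realization K) where
  toFun z := ofCoords hs e (cubeToSimplex d z) (cubeToSimplex_mem z)
  invFun p := simplexToCube d fun i => p.weight (e.symm i)
  source := Metric.ball 0 1
  target := openSimplex K s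
  map_source' z hz := by
    rw [ofCoords_mem_openSimplex_iff, ← simplexToCube_mem_ball_iff (cubeToSimplex_mem z),
      simplexToCube_cubeToSimplex (Metric.ball_subset_closedBall hz)]
    exact hz
  map_target' p hp := by
    have hp' := openSimplex_subset_closedSimplex hp
    rw [simplexToCube_mem_ball_iff (coords_mem_stdSimplex e hp'),
      ← ofCoords_mem_openSimplex_iff hs (e := e) (coords_mem_stdSimplex e hp'),
      ofCoords_coords hs e hp']
    exact hp
  left_inv' z hz := by
    simp only [ofCoords_weight_coe, e.apply_symm_apply]
    exact simplexToCube_cubeToSimplex (Metric.ball_subset_closedBall hz)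
  right_inv' p hp := by
    have hp' := openSimplex_subset_closedSimplex hp
    simp only [cubeToSimplex_simplexToCube (coords_mem_stdSimplex e hp'), ofCoords_coords hs e hp']

variable (hs : s ∈ K.faces) (e : s ≃ Fin (d + 1))

theorem charMap_apply (z : Fin d → ℝ) :
    charMap hs e z = ofCoords hs e (cubeToSimplex d z) (cubeToSimplex_mem z) :=
  rfl

theorem charMap_mem_closedSimplex (z : Fin d → ℝ) : charMap hs e z ∈ closedSimplex K s :=
  ofCoords_mem_closedSimplex hs (cubeToSimplex_mem z)

theorem charMap_image_ball : charMap hs e '' Metric.ball 0 1 = openSimplex K s :=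
  (charMap hs e).image_source_eq_target

theorem charMap_image_closedBall :
    charMap hs e '' Metric.closedBall 0 1 = closedSimplex K s := by
  refine Set.Subset.antisymm ?_ fun p hp => ?_
  · rintro _ ⟨z, -, rfl⟩
    exact charMap_mem_closedSimplex hs e z
  · refine ⟨_, simplexToCube_mem_closedBall (coords_mem_stdSimplex e hp), ?_⟩
    simp only [charMap_apply, cubeToSimplex_simplexToCube (coords_mem_stdSimplex e hp),
      ofCoords_coords hs e hp]

theorem charMap_mem_openSimplex_iff {z : Fin d → ℝ} (hz : z ∈ Metric.closedBall 0 1) :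
    charMap hs e z ∈ openSimplex K s ↔ z ∈ Metric.ball 0 1 := by
  rw [charMap_apply, ofCoords_mem_openSimplex_iff,
    ← simplexToCube_mem_ball_iff (cubeToSimplex_mem z), simplexToCube_cubeToSimplex hz]

theorem continuousOn_charMap : ContinuousOn (charMap hs e) (Metric.closedBall 0 1) := by
  refine continuousOn_of_weight hs (fun z _ => charMap_mem_closedSimplex hs e z) fun v => ?_
  simp only [charMap_apply]
  by_cases hv : v ∈ s
  · simp only [ofCoords_weight_coe hs _ ⟨v, hv⟩]
    exact (continuous_apply _).comp_continuousOn continuousOn_cubeToSimplex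
  · simp only [ofCoords_weight_of_notMem hs _ hv]
    exact continuousOn_const

theorem continuous_charMap_symm : Continuous (charMap hs e).symm :=
  continuous_simplexToCube.comp (continuous_pi fun _ => continuous_weight_apply _)

end charMap

/-- The CW-structure on the geometric realization of a simplicial complex whose `d`-cells are the
open simplices of dimension `d`, for a given numbering of the vertices of each face. -/
@[reducible]
noncomputable def cwComplex (K : PreAbstractSimplicialComplex ι)
    (e : ∀ (d : ℕ) (s : Finset ι), s ∈ K.faces → s.card = d + 1 → (s ≃ Fin (d + 1))) :
    Topology.CWComplex (Set.univ : Set (Realization K)) where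
  cell d := {s : Finset ι // s ∈ K.faces ∧ s.card = d + 1}
  map d s := charMap s.2.1 (e d s.1 s.2.1 s.2.2)
  source_eq _ _ := rfl
  continuousOn d s := continuousOn_charMap _ _
  continuousOn_symm d s := (continuous_charMap_symm _ _).continuousOn
  pairwiseDisjoint' := by
    rintro ⟨d, s, hs, hsd⟩ - ⟨d', s', hs', hsd'⟩ - hne
    simp only [Function.onFun, charMap_image_ball]
    rw [Set.disjoint_left]
    intro p (hp : p.weight.support = s) (hp' : p.weight.support = s')
    apply hne
    subst hp
    subst hp'
    obtain rfl : d = d' := by lia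
    rfl
  mapsTo' d s := by
    classical
    have hfin : ∀ m, {t : {t : Finset ι // t ∈ K.faces ∧ t.card = m + 1} | t.1 ⊆ s.1}.Finite := by
      intro m
      refine Set.Finite.of_finite_image (f := Subtype.val) (s.1.powerset.finite_toSet.subset ?_)
        Subtype.val_injective.injOn
      rintro _ ⟨t, ht, rfl⟩
      simpa using ht
    refine ⟨fun m => (hfin m).toFinset, fun z hz => ?_⟩
    set p := charMap s.2.1 (e d s.1 s.2.1 s.2.2) z with hp
    have hps : p.weight.support ⊆ s.1 := charMap_mem_closedSimplex _ _ _
    have hne : p.weight.support ≠ s.1 := by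
      intro h
      have := (charMap_mem_openSimplex_iff s.2.1 (e d s.1 s.2.1 s.2.2)
        (Metric.sphere_subset_closedBall hz)).1 h
      rw [mem_ball_zero_iff] at this
      rw [mem_sphere_zero_iff_norm] at hz
      exact this.ne hz
    have hlt := Finset.card_lt_card (hps.ssubset_of_ne hne)
    have hpos : 0 < p.weight.support.card :=
      Finset.card_pos.2 (K.isRelLowerSet_faces p.support_mem).1
    have h2 := s.2.2
    simp only [Set.mem_iUnion]
    refine ⟨p.weight.support.card - 1, by lia, ⟨p.weight.support, p.support_mem, by lia⟩, ?_, ?_⟩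
    · simpa using hps
    · rw [charMap_image_closedBall]
      exact Finset.Subset.refl _
  closed' A _ h := by
    refine isClosed_of_inter_closedSimplex fun s hs => ?_
    have hpos : 0 < s.card := Finset.card_pos.2 (K.isRelLowerSet_faces hs).1
    have := h (s.card - 1) ⟨s, hs, by lia⟩
    rwa [charMap_image_closedBall] at this
  union' := by
    refine Set.eq_univ_of_forall fun p => ?_
    have hpos : 0 < p.weight.support.card :=
      Finset.card_pos.2 (K.isRelLowerSet_faces p.support_mem).1
    simp only [Set.mem_iUnion]
    refine ⟨p.weight.support.card - 1, ⟨p.weight.support, p.support_mem, by lia⟩, ?_⟩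
    rw [charMap_image_closedBall]
    exact Finset.Subset.refl _

end Realization

/-! ### The nerve of a good open cover as an equivariant CW-complex -/

section Numbering

variable {ι : Type*} {Ω : Type*} [LinearOrder Ω] (χ : ι → Ω) {s : Finset ι}

/-- Counting the elements of smaller colour numbers the elements of `s` by `0, …, m - 1`. -/
theorem bijective_card_filter_lt (hχ : Set.InjOn χ s) {m : ℕ} (hm : s.card = m) :
    ∃ h : ∀ v : s, (s.filter fun u => χ u < χ v).card < m,
      Function.Bijective fun v : s => (⟨_, h v⟩ : Fin m) := by
  have hlt : ∀ v : s, (s.filter fun u => χ u < χ v).card < m := by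
    intro v
    rw [← hm]
    refine Finset.card_lt_card ⟨Finset.filter_subset _ _, fun h => ?_⟩
    exact lt_irrefl _ (Finset.mem_filter.1 (h v.2)).2
  have hmono : ∀ v w : s, χ v < χ w →
      (s.filter fun u => χ u < χ v).card < (s.filter fun u => χ u < χ w).card := by
    intro v w hvw
    refine Finset.card_lt_card ⟨fun u hu => ?_, fun h => ?_⟩
    · rw [Finset.mem_filter] at hu ⊢
      exact ⟨hu.1, hu.2.trans hvw⟩
    · exact lt_irrefl _ (Finset.mem_filter.1 (h (Finset.mem_filter.2 ⟨v.2, hvw⟩))).2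
  refine ⟨hlt, (Fintype.bijective_iff_injective_and_card _).2 ⟨fun v w hvw => ?_, by simp [hm]⟩⟩
  have hvw' := congrArg Fin.val hvw
  rcases lt_trichotomy (χ v) (χ w) with h | h | h
  · exact absurd hvw' (hmono v w h).ne
  · exact Subtype.ext (hχ v.2 w.2 h)
  · exact absurd hvw' (hmono w v h).ne'

/-- The numbering of the elements of a finite set `s` by increasing colour, for a colouring `χ`
that is injective on `s`. -/
noncomputable def colorNumbering (hχ : Set.InjOn χ s) {m : ℕ} (hm : s.card = m) : s ≃ Fin m :=
  Equiv.ofBijective _ (bijective_card_filter_lt χ hχ hm).choose_spec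

theorem colorNumbering_map (σ : ι ↪ ι) (hσ : ∀ v, χ (σ v) = χ v) (hχ : Set.InjOn χ s)
    (hχ' : Set.InjOn χ (s.map σ)) {m : ℕ} (hm : s.card = m) (hm' : (s.map σ).card = m) (v : s) :
    colorNumbering χ hχ' hm' ⟨σ v, Finset.mem_map_of_mem σ v.2⟩ = colorNumbering χ hχ hm v := by
  apply Fin.ext
  change ((s.map σ).filter fun u => χ u < χ (σ v)).card = (s.filter fun u => χ u < χ v).card
  rw [Finset.filter_map, Finset.card_map]
  simp only [Function.comp_def, hσ]

end Numbering

namespace GoodOpenCover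

variable {G : Type v} {X : Type u} [Group G] [TopologicalSpace X] [MulAction G X]
  (𝒱 : GoodOpenCover G X)

theorem smul_eq_of_nonempty {V : Set X} (hV : V ∈ 𝒱.sets) {g : G}
    (h : (g • V ∩ V).Nonempty) : g • V = V := by
  obtain ⟨x, hx⟩ := 𝒱.good V hV
  exact (hx g).1.1 h

/-- Translates of one member of a good cover never span a simplex together, so the orbit map
separates the vertices of every simplex of the nerve. -/
theorem injOn_orbit {s : Finset (Set X)} (hs : s ∈ (nerve 𝒱.sets).faces) :
    Set.InjOn (fun V => (Quotient.mk (MulAction.orbitRel G (Set X)) V)) s := by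
  obtain ⟨-, hsub, x, hx⟩ := hs
  intro V hV W hW h
  obtain ⟨g, hg⟩ : V ∈ MulAction.orbit G W := Quotient.exact h
  have hg' : g • W = V := hg
  rw [← 𝒱.smul_eq_of_nonempty (hsub hW) (g := g) ⟨x, by rw [hg']; exact hx V hV, hx W hW⟩, hg']

theorem map_mem_faces (g : G) {s : Finset (Set X)} (hs : s ∈ (nerve 𝒱.sets).faces) :
    s.map (MulAction.toPerm g).toEmbedding ∈ (nerve 𝒱.sets).faces := by
  obtain ⟨h1, h2, x, hx⟩ := hs
  refine ⟨by simpa using h1, ?_, g • x, ?_⟩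
  · intro V hV
    simp only [Finset.coe_map, Set.mem_image] at hV
    obtain ⟨W, hW, rfl⟩ := hV
    exact 𝒱.smul_mem g W (h2 hW)
  · intro V hV
    simp only [Finset.coe_map, Set.mem_image] at hV
    obtain ⟨W, hW, rfl⟩ := hV
    exact Set.smul_mem_smul_set (hx W hW)

theorem smul_weight (g : G) (p : 𝒱.Nerve) (V : Set X) :
    (g • p).weight V = p.weight (g⁻¹ • V) :=
  rfl

theorem support_smul (g : G) (p : 𝒱.Nerve) :
    (g • p).weight.support = p.weight.support.map (MulAction.toPerm g).toEmbedding :=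
  rfl

theorem continuous_smul_nerve (g : G) : Continuous fun p : 𝒱.Nerve => g • p := by
  refine continuous_iSup_dom.2 fun s => continuous_coinduced_dom.2 ?_
  let _ : TopologicalSpace (Realization.closedSimplex (nerve 𝒱.sets) s.1) :=
    TopologicalSpace.induced (fun p (i : Set X) => p.1.weight i) inferInstance
  rw [← continuousOn_univ]
  refine Realization.continuousOn_of_weight (𝒱.map_mem_faces g s.2)
    (fun p _ => Finset.map_subset_map.2 p.2) fun V => Continuous.continuousOn ?_
  exact (continuous_apply (g⁻¹ • V)).comp continuous_induced_dom

open Classical in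
/-- A linear order on the orbits of subsets of `X`. It orders the vertices of each simplex of the
nerve, compatibly with the action. -/
noncomputable abbrev orbitLinearOrder (G : Type v) (X : Type u) [Group G] [MulAction G X] :
    LinearOrder (Quotient (MulAction.orbitRel G (Set X))) :=
  linearOrderOfSTO WellOrderingRel

/-- The numbering of the vertices of a simplex of the nerve by their orbits. -/
noncomputable def vertexNumbering (d : ℕ) (s : Finset (Set X)) (hs : s ∈ (nerve 𝒱.sets).faces)
    (hd : s.card = d + 1) : s ≃ Fin (d + 1) :=
  letI := orbitLinearOrder G X
  colorNumbering _ (𝒱.injOn_orbit hs) hd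

theorem vertexNumbering_map (g : G) (d : ℕ) (s : Finset (Set X)) (hs : s ∈ (nerve 𝒱.sets).faces)
    (hd : s.card = d + 1) (hd' : (s.map (MulAction.toPerm g).toEmbedding).card = d + 1) (v : s) :
    𝒱.vertexNumbering d _ (𝒱.map_mem_faces g hs) hd'
      ⟨g • (v : Set X), Finset.mem_map_of_mem (MulAction.toPerm g).toEmbedding v.2⟩ =
      𝒱.vertexNumbering d s hs hd v := by
  let _ := orbitLinearOrder G X
  exact colorNumbering_map _ (MulAction.toPerm g).toEmbedding
    (fun V => Quotient.sound (MulAction.mem_orbit V g)) (𝒱.injOn_orbit hs) _ hd hd' v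

/-- The nerve of a good open cover as a `G`-CW-complex, the cells being the open simplices. -/
noncomputable def nerveGCWComplex : GCWComplex G 𝒱.Nerve where
  t2Space := inferInstance
  continuous_smul := 𝒱.continuous_smul_nerve
  cw := Realization.cwComplex (nerve 𝒱.sets) 𝒱.vertexNumbering
  cellAction d :=
    { smul g s := ⟨s.1.map (MulAction.toPerm g).toEmbedding, 𝒱.map_mem_faces g s.2.1,
        (Finset.card_map _).trans s.2.2⟩
      one_smul s := by
        apply Subtype.ext
        change s.1.map (MulAction.toPerm (1 : G)).toEmbedding = s.1
        ext V
        simp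
      mul_smul g h s := by
        apply Subtype.ext
        change s.1.map (MulAction.toPerm (g * h)).toEmbedding =
          (s.1.map (MulAction.toPerm h).toEmbedding).map (MulAction.toPerm g).toEmbedding
        rw [Finset.map_map]
        congr 1
        ext V : 1
        exact mul_smul g h V }
  map_smul g d s z _ := by
    obtain ⟨s, hs, hd⟩ := s
    have hd' : (s.map (MulAction.toPerm g).toEmbedding).card = d + 1 :=
      (Finset.card_map _).trans hd
    change Realization.charMap (𝒱.map_mem_faces g hs) (𝒱.vertexNumbering d _ _ hd') z =
      g • Realization.charMap hs (𝒱.vertexNumbering d s hs hd) z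
    refine Realization.ext (Finsupp.ext fun V => ?_)
    obtain ⟨W, rfl⟩ : ∃ W, V = g • W := ⟨g⁻¹ • V, (smul_inv_smul g V).symm⟩
    rw [smul_weight, inv_smul_smul, Realization.charMap_apply, Realization.charMap_apply]
    by_cases hW : W ∈ s
    · rw [Realization.ofCoords_weight_coe hs _ ⟨W, hW⟩,
        Realization.ofCoords_weight_coe (𝒱.map_mem_faces g hs) _
          ⟨g • W, Finset.mem_map_of_mem (MulAction.toPerm g).toEmbedding hW⟩,
        ← 𝒱.vertexNumbering_map g d s hs hd hd' ⟨W, hW⟩]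
    · rw [Realization.ofCoords_weight_of_notMem hs _ hW,
        Realization.ofCoords_weight_of_notMem]
      intro h
      obtain ⟨W', hW', h⟩ := Finset.mem_map.1 h
      exact hW (by rwa [← (MulAction.toPerm g).injective h])

theorem nerveGCWComplex_openCells (d : ℕ) :
    𝒱.nerveGCWComplex.openCells d = {e | ∃ s ∈ (nerve 𝒱.sets).faces, s.card = d + 1 ∧
      e = Realization.openSimplex (nerve 𝒱.sets) s} := by
  ext A
  constructor
  · rintro ⟨⟨s, hs, hd⟩, rfl⟩
    exact ⟨s, hs, hd, Realization.charMap_image_ball hs _⟩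
  · rintro ⟨s, hs, hd, rfl⟩
    exact ⟨⟨s, hs, hd⟩, Realization.charMap_image_ball hs _⟩

theorem nerveGCWComplex_dimLE {n : ℕ} (h : ∀ s ∈ (nerve 𝒱.sets).faces, s.card ≤ n + 1) :
    𝒱.nerveGCWComplex.DimLE n := by
  intro m hm
  refine ⟨fun s : {s : Finset (Set X) // s ∈ (nerve 𝒱.sets).faces ∧ s.card = m + 1} => ?_⟩
  have := h s.1 s.2.1
  have := s.2.2
  lia

/-- A group element fixing a point of the nerve permutes the vertices of its carrier simplex, hence
fixes each of them. -/
theorem stabilizer_nerve_le (y : 𝒱.Nerve) :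
    ∃ x : X, MulAction.stabilizer G y ≤ MulAction.stabilizer G x := by
  obtain ⟨⟨V, hV⟩, hsub, x, hx⟩ := y.support_mem
  obtain ⟨z, hz⟩ := 𝒱.good V (hsub hV)
  refine ⟨z, fun g hg => ?_⟩
  have hgV : g • V ∈ y.weight.support := by
    rw [← MulAction.mem_stabilizer_iff.1 hg, support_smul]
    exact Finset.mem_map_of_mem (MulAction.toPerm g).toEmbedding hV
  exact (hz g).2.1 ((hz g).1.1 ⟨x, hx _ hgV, hx _ hV⟩)

end GoodOpenCover

/-! ### Covering dimension and refinements of bounded order -/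

section CoveringDimension

theorem card_le_of_coverDim_le {X : Type u} {𝒱 : Set (Set X)} {n : ℕ} (h : coverDim 𝒱 ≤ n)
    {s : Finset (Set X)} (hs : (s : Set (Set X)) ⊆ 𝒱)
    (hne : (⋂₀ (s : Set (Set X))).Nonempty) : s.card ≤ n + 1 := by
  by_contra! hlt
  have h' : coverDim 𝒱 < ((n + 1 : ℕ) : ℕ∞) := h.trans_lt (by exact_mod_cast n.lt_succ_self)
  simp only [coverDim, iInf_lt_iff, Nat.cast_lt] at h'
  obtain ⟨d, hd, hdn⟩ := h'
  obtain ⟨t, hts, ht⟩ := Finset.exists_subset_card_eq (s := s) (n := d + 2) (by lia)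
  have := hd t ((Finset.coe_subset.2 hts).trans hs) ht
  exact (hne.mono (Set.sInter_subset_sInter (Finset.coe_subset.2 hts))).ne_empty this

/-- Covering dimension in terms of indexed covers: the refinement can be taken with the same index
set, bounding the number of indices, rather than the number of distinct members, at each point. -/
theorem exists_precise_refinement_of_topDim_le {X : Type u} [TopologicalSpace X] {n : ℕ}
    (hdim : topDim X ≤ n) {ι : Type*} (U : ι → Set X) (hU : ∀ i, IsOpen (U i))
    (hcov : ⋃ i, U i = Set.univ) :
    ∃ V : ι → Set X, (∀ i, IsOpen (V i)) ∧ ⋃ i, V i = Set.univ ∧ (∀ i, V i ⊆ U i) ∧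
      ∀ x, ∀ T : Finset ι, (∀ i ∈ T, x ∈ V i) → T.card ≤ n + 1 := by
  classical
  have h' : topDim X < ((n + 1 : ℕ) : ℕ∞) := hdim.trans_lt (by exact_mod_cast n.lt_succ_self)
  simp only [topDim, iInf_lt_iff, Nat.cast_lt] at h'
  obtain ⟨d, hd, hdn⟩ := h'
  obtain ⟨𝒱, h𝒱, href, hcd⟩ := hd (Set.range U)
    ⟨by rintro _ ⟨i, rfl⟩; exact hU i, by rwa [Set.sUnion_range]⟩
  have hidx : ∀ V : 𝒱, ∃ i, (V : Set X) ⊆ U i := by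
    intro V
    obtain ⟨_, ⟨i, rfl⟩, hi⟩ := href V V.2
    exact ⟨i, hi⟩
  choose idx hidx using hidx
  refine ⟨fun i => ⋃ V : 𝒱, ⋃ _ : idx V = i, V, ?_, ?_, ?_, ?_⟩
  · exact fun i => isOpen_iUnion fun V => isOpen_iUnion fun _ => h𝒱.isOpen V V.2
  · refine Set.eq_univ_of_forall fun x => ?_
    obtain ⟨V, hV, hx⟩ : x ∈ ⋃₀ 𝒱 := h𝒱.sUnion_eq ▸ Set.mem_univ x
    simp only [Set.mem_iUnion]
    exact ⟨_, ⟨V, hV⟩, rfl, hx⟩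
  · intro i
    refine Set.iUnion_subset fun V => Set.iUnion_subset fun h => ?_
    rw [← h]
    exact hidx V
  · intro x T hT
    have hT' : ∀ i ∈ T, ∃ V : Set X, (∃ h : V ∈ 𝒱, idx ⟨V, h⟩ = i) ∧ x ∈ V := by
      intro i hi
      obtain ⟨V, hV, hx⟩ := Set.mem_iUnion₂.1 (hT i hi)
      exact ⟨V, ⟨V.2, hV⟩, hx⟩
    choose! V hV hxV using hT'
    have hinj : Set.InjOn V T := by
      intro i hi j hj hij
      obtain ⟨h1, h2⟩ := hV i hi
      obtain ⟨h3, h4⟩ := hV j hj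
      rw [← h2, ← h4]
      exact congrArg idx (Subtype.ext hij)
    rw [← Finset.card_image_of_injOn hinj]
    refine (card_le_of_coverDim_le hcd ?_ ⟨x, ?_⟩).trans (by lia)
    · intro W hW
      simp only [Finset.coe_image, Set.mem_image] at hW
      obtain ⟨i, hi, rfl⟩ := hW
      exact (hV i hi).1
    · intro W hW
      simp only [Finset.coe_image, Set.mem_image] at hW
      obtain ⟨i, hi, rfl⟩ := hW
      exact hxV i hi

/-- A locally finite closed family in a metric space can be enlarged to an open family without
creating new nonempty intersections. -/
theorem exists_open_swelling {Z : Type*} [MetricSpace Z] {ι : Type*} (F U : ι → Set Z)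
    (hF : ∀ i, IsClosed (F i)) (hlf : LocallyFinite F) (hU : ∀ i, IsOpen (U i))
    (hFU : ∀ i, F i ⊆ U i) :
    ∃ W : ι → Set Z, (∀ i, IsOpen (W i)) ∧ (∀ i, F i ⊆ W i) ∧ (∀ i, W i ⊆ U i) ∧
      ∀ T : Finset ι, (∃ z, ∀ i ∈ T, z ∈ W i) → ∃ z, ∀ i ∈ T, z ∈ F i := by
  have hr : ∀ y : Z, ∃ r > 0, ∀ i, (F i ∩ Metric.ball y r).Nonempty → y ∈ F i := by
    intro y
    obtain ⟨N, hN, hfin⟩ := hlf y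
    have hN2 : (⋂ i ∈ {i | (F i ∩ N).Nonempty ∧ y ∉ F i}, (F i)ᶜ) ∈ nhds y :=
      (Filter.biInter_mem (hfin.subset fun i hi => hi.1)).2
        fun i hi => (hF i).isOpen_compl.mem_nhds hi.2
    obtain ⟨r, hr, hball⟩ := Metric.mem_nhds_iff.1 (Filter.inter_mem hN hN2)
    refine ⟨r, hr, ?_⟩
    rintro i ⟨z, hzF, hzr⟩
    by_contra hy
    have := Set.mem_iInter₂.1 (hball hzr).2 i ⟨⟨z, hzF, (hball hzr).1⟩, hy⟩
    exact this hzF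
  choose r hr0 hr using hr
  refine ⟨fun i => U i ∩ ⋃ y ∈ F i, Metric.ball y (r y / 2), ?_, ?_, ?_, ?_⟩
  · exact fun i => (hU i).inter (isOpen_biUnion fun y _ => Metric.isOpen_ball)
  · exact fun i y hy => ⟨hFU i hy,
      Set.mem_biUnion hy (Metric.mem_ball_self (half_pos (hr0 y)))⟩
  · exact fun i => Set.inter_subset_left
  · rintro T ⟨z, hz⟩
    rcases T.eq_empty_or_nonempty with rfl | hT
    · exact ⟨z, by simp⟩
    have hz' : ∀ i ∈ T, ∃ y ∈ F i, dist z y < r y / 2 := by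
      intro i hi
      obtain ⟨y, hy, hzy⟩ := Set.mem_iUnion₂.1 (hz i hi).2
      exact ⟨y, hy, hzy⟩
    have : Nonempty Z := ⟨z⟩
    choose! y hyF hzy using hz'
    -- The centre with the largest radius lies in every `F j`.
    obtain ⟨i, hi, hmax⟩ := T.exists_max_image (fun i => r (y i)) hT
    refine ⟨y i, fun j hj => hr (y i) j ⟨y j, hyF j hj, ?_⟩⟩
    have h1 := hzy i hi
    have h2 := hzy j hj
    have h3 := hmax j hj
    rw [Metric.mem_ball]
    have := dist_triangle_left (y j) (y i) z
    linarith

/-- The inductive part of the countable sum theorem: if refinements of order at most `n + 1` exist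
on each of countably many sets covering a normal space, shrinking successively yields a closed
refinement of order at most `n + 1` everywhere. -/
theorem exists_closed_refinement_of_forall_nat {Z : Type*} [TopologicalSpace Z] [NormalSpace Z]
    {ι : Type*} {n : ℕ} (C : ℕ → Set Z) (hC : ⋃ k, C k = Set.univ)
    (hdim : ∀ (k : ℕ) (U : ι → Set Z), (∀ i, IsOpen (U i)) → ⋃ i, U i = Set.univ →
      ∃ P : ι → Set Z, (∀ i, IsOpen (P i)) ∧ ⋃ i, P i = Set.univ ∧ (∀ i, P i ⊆ U i) ∧
        ∀ z ∈ C k, ∀ T : Finset ι, (∀ i ∈ T, z ∈ P i) → T.card ≤ n + 1)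
    (U : ι → Set Z) (hU : ∀ i, IsOpen (U i)) (hcov : ⋃ i, U i = Set.univ)
    (hfin : ∀ z, {i | z ∈ U i}.Finite) :
    ∃ F : ι → Set Z, (∀ i, IsClosed (F i)) ∧ ⋃ i, F i = Set.univ ∧ (∀ i, F i ⊆ U i) ∧
      ∀ z, ∀ T : Finset ι, (∀ i ∈ T, z ∈ F i) → T.card ≤ n + 1 := by
  let S := {V : ι → Set Z // (∀ i, IsOpen (V i)) ∧ ⋃ i, V i = Set.univ ∧ ∀ i, V i ⊆ U i}
  have hstep : ∀ (k : ℕ) (V : S), ∃ V' : S, (∀ i, closure (V'.1 i) ⊆ V.1 i) ∧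
      ∀ z ∈ C k, ∀ T : Finset ι, (∀ i ∈ T, z ∈ V'.1 i) → T.card ≤ n + 1 := by
    rintro k ⟨V, hVo, hVc, hVU⟩
    obtain ⟨P, hPo, hPc, hPV, hP⟩ := hdim k V hVo hVc
    obtain ⟨V', hV'c, hV'o, hV'P⟩ := exists_iUnion_eq_closure_subset hPo
      (fun z => (hfin z).subset fun i hi => hVU i (hPV i hi)) hPc
    refine ⟨⟨V', hV'o, hV'c, fun i => subset_closure.trans ((hV'P i).trans
      ((hPV i).trans (hVU i)))⟩, fun i => (hV'P i).trans (hPV i), fun z hz T hT => ?_⟩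
    exact hP z hz T fun i hi => hV'P i (subset_closure (hT i hi))
  choose step hstep1 hstep2 using hstep
  let V : ℕ → S := fun k => Nat.rec ⟨U, hU, hcov, fun _ => subset_rfl⟩ step k
  have hanti : ∀ i, Antitone fun k => (V k).1 i := fun i =>
    antitone_nat_of_succ_le fun k => subset_closure.trans (hstep1 k (V k) i)
  refine ⟨fun i => ⋂ k, (V k).1 i, fun i => ?_, ?_, fun i => Set.iInter_subset _ 0, ?_⟩
  · have : ⋂ k, (V k).1 i = ⋂ k, closure ((V (k + 1)).1 i) := by
      refine Set.Subset.antisymm ?_ ?_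
      · exact Set.subset_iInter fun k => (Set.iInter_subset _ (k + 1)).trans subset_closure
      · exact Set.iInter_mono fun k => hstep1 k (V k) i
    change IsClosed (⋂ k, (V k).1 i)
    rw [this]
    exact isClosed_iInter fun k => isClosed_closure
  · refine Set.eq_univ_of_forall fun z => ?_
    by_contra hz
    simp only [Set.mem_iUnion, Set.mem_iInter, not_exists, not_forall] at hz
    choose k hk using hz
    -- Only finitely many indices matter at `z`, so some stage of the shrinking misses `z`.
    obtain ⟨m, hm⟩ := ((hfin z).image k).bddAbove
    obtain ⟨i, hi⟩ := Set.iUnion_eq_univ_iff.1 (V m).2.2.1 z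
    exact hk i (hanti i (hm ⟨i, (V m).2.2.2 i hi, rfl⟩) hi)
  · intro z T hT
    obtain ⟨k, hk⟩ := Set.iUnion_eq_univ_iff.1 hC z
    exact hstep2 k (V k) z hk T fun i hi => Set.mem_iInter.1 (hT i hi) (k + 1)

end CoveringDimension

/-! ### The orbit space of an isometric action with discrete orbits -/

section OrbitRel

variable {G : Type v} {X : Type u} [Group G] [MulAction G X]

theorem orbitRel_mk_eq_iff {x y : X} :
    Quotient.mk (MulAction.orbitRel G X) y = Quotient.mk (MulAction.orbitRel G X) x ↔
      ∃ g : G, g • x = y :=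
  Quotient.eq

theorem orbitRel_mk_smul (g : G) (x : X) :
    Quotient.mk (MulAction.orbitRel G X) (g • x) = Quotient.mk (MulAction.orbitRel G X) x :=
  orbitRel_mk_eq_iff.2 ⟨g, rfl⟩

end OrbitRel

section IsometricAction

variable {G : Type v} {X : Type u} [Group G] [MetricSpace X] [MulAction G X]

/-- If the orbit of `x` is discrete, then `x` is at positive distance from the rest of its orbit. -/
theorem exists_pos_forall_smul_eq {x : X} (hx : DiscreteTopology (MulAction.orbit G x)) :
    ∃ ε > 0, ∀ g : G, dist (g • x) x < ε → g • x = x := by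
  obtain ⟨ε, hε, h⟩ := Metric.exists_ball_inter_eq_singleton_of_mem_discrete
    (isDiscrete_iff_discreteTopology.2 hx) (MulAction.mem_orbit_self x)
  refine ⟨ε, hε, fun g hg => ?_⟩
  have : g • x ∈ Metric.ball x ε ∩ MulAction.orbit G x := ⟨hg, MulAction.mem_orbit x g⟩
  rwa [h] at this

/-- The points of the closed ball of radius `r` around `q` whose orbit has no other points at
distance less than `4 * r`. The orbit map is injective on this set. -/
def isolatedInOrbit (G : Type v) {X : Type u} [Group G] [MetricSpace X] [MulAction G X] (q : X)
    (r : ℝ) : Set X :=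
  {x | dist x q ≤ r ∧ ∀ g : G, dist (g • x) x < 4 * r → g • x = x}

/-- Two points of `isolatedInOrbit G q r` in the same orbit are within `2 * r` of each other, hence
equal. -/
theorem smul_eq_of_mem_isolatedInOrbit {q x : X} {r : ℝ} (hr : 0 < r) {g : G}
    (hx : x ∈ isolatedInOrbit G q r) (hgx : g • x ∈ isolatedInOrbit G q r) : g • x = x := by
  refine hx.2 g ?_
  have := dist_triangle_right (g • x) x q
  have := hx.1
  have := hgx.1
  linarith

variable [IsIsometricSMul G X]

theorem isClosed_orbit_of_discreteTopology {x : X}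
    (hx : DiscreteTopology (MulAction.orbit G x)) : IsClosed (MulAction.orbit G x) := by
  obtain ⟨ε, hε, h⟩ := exists_pos_forall_smul_eq hx
  refine isClosed_of_closure_subset fun y hy => ?_
  obtain ⟨_, ⟨g, rfl⟩, hg⟩ := Metric.mem_closure_iff.1 hy (ε / 2) (half_pos hε)
  refine ⟨g, ?_⟩
  refine (eq_of_forall_dist_le fun δ hδ => ?_).symm
  obtain ⟨_, ⟨k, rfl⟩, hk⟩ := Metric.mem_closure_iff.1 hy (min δ (ε / 2))
    (lt_min hδ (half_pos hε))
  have hkg : dist ((g⁻¹ * k) • x) x < ε := by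
    rw [← dist_smul g, smul_smul, mul_inv_cancel_left]
    have h1 := dist_triangle_left (k • x) (g • x) y
    have h2 := hk.trans_le (min_le_right _ _)
    simp only at hg h2
    linarith
  have heq : k • x = g • x := by
    have := congrArg (g • ·) (h _ hkg)
    simpa [smul_smul] using this
  simp only at hk ⊢
  rw [← heq]
  exact (hk.trans_le (min_le_left _ _)).le

theorem t3Space_quotient_orbitRel (hdisc : ∀ x : X, DiscreteTopology (MulAction.orbit G x)) :
    T3Space (Quotient (MulAction.orbitRel G X)) := by
  have hπ : IsOpenQuotientMap (Quotient.mk (MulAction.orbitRel G X)) :=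
    MulAction.isOpenQuotientMap_quotientMk
  have : T1Space (Quotient (MulAction.orbitRel G X)) := by
    refine ⟨fun q => ?_⟩
    obtain ⟨x, rfl⟩ := hπ.surjective q
    rw [← hπ.isQuotientMap.isClosed_preimage]
    convert isClosed_orbit_of_discreteTopology (hdisc x) using 1
    ext y
    exact orbitRel_mk_eq_iff
  have : RegularSpace (Quotient (MulAction.orbitRel G X)) := by
    refine RegularSpace.of_exists_mem_nhds_isClosed_subset fun q s hs => ?_
    obtain ⟨x, rfl⟩ := hπ.surjective q
    obtain ⟨r, hr, hrs⟩ := Metric.mem_nhds_iff.1 (hπ.continuous.continuousAt hs)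
    refine ⟨closure (Quotient.mk _ '' Metric.ball x (r / 2)), Filter.mem_of_superset
      (hπ.isOpenMap.image_mem_nhds (Metric.ball_mem_nhds x (half_pos hr))) subset_closure,
      isClosed_closure, fun q hq => ?_⟩
    obtain ⟨y, rfl⟩ := hπ.surjective q
    rw [← Set.mem_preimage, hπ.isOpenMap.preimage_closure_eq_closure_preimage hπ.continuous] at hq
    obtain ⟨z, ⟨b, hb, hbz⟩, hyz⟩ := Metric.mem_closure_iff.1 hq (r / 2) (half_pos hr)
    obtain ⟨g, rfl⟩ := orbitRel_mk_eq_iff.1 hbz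
    have hmem : g • y ∈ Metric.ball x r := by
      rw [Metric.mem_ball]
      rw [Metric.mem_ball] at hb
      have := dist_triangle (g • y) (g • z) x
      rw [dist_smul] at this
      linarith
    have := hrs hmem
    rwa [Set.mem_preimage, orbitRel_mk_smul] at this
  infer_instance

theorem isClosed_isolatedInOrbit (q : X) (r : ℝ) : IsClosed (isolatedInOrbit G q r) := by
  refine isClosed_of_closure_subset fun x hx => ⟨?_, fun g hg => ?_⟩
  · exact closure_minimal (fun y hy => hy.1)
      (isClosed_le (continuous_id.dist continuous_const) continuous_const) hx
  · have hfix : IsClosed {y : X | g • y = y} := isClosed_eq (continuous_const_smul g) continuous_id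
    have hopen : IsOpen {y : X | dist (g • y) y < 4 * r} :=
      isOpen_lt ((continuous_const_smul g).dist continuous_id) continuous_const
    refine closure_minimal ?_ hfix (hopen.inter_closure ⟨hg, hx⟩)
    exact fun y hy => hy.2.2 g hy.1

theorem isClosed_mk_image_isolatedInOrbit (q : X) {r : ℝ} (hr : 0 < r) :
    IsClosed (Quotient.mk (MulAction.orbitRel G X) '' isolatedInOrbit G q r) := by
  have hπ : IsOpenQuotientMap (Quotient.mk (MulAction.orbitRel G X)) :=
    MulAction.isOpenQuotientMap_quotientMk
  rw [← hπ.isQuotientMap.isClosed_preimage]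
  refine isClosed_of_closure_subset fun y hy => ?_
  have happ : ∀ δ > 0, ∃ x ∈ isolatedInOrbit G q r, ∃ g : G, dist y (g • x) < δ := by
    intro δ hδ
    obtain ⟨z, ⟨x, hx, hxz⟩, hyz⟩ := Metric.mem_closure_iff.1 hy δ hδ
    obtain ⟨g, rfl⟩ := orbitRel_mk_eq_iff.1 hxz.symm
    exact ⟨x, hx, g, hyz⟩
  obtain ⟨x, hx, g, hg⟩ := happ r hr
  -- The translate of `y` close to one point of the set is a limit of points of the set.
  refine ⟨g⁻¹ • y, ?_, orbitRel_mk_smul _ _⟩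
  rw [← (isClosed_isolatedInOrbit (G := G) q r).closure_eq]
  refine Metric.mem_closure_iff.2 fun δ hδ => ?_
  obtain ⟨x', hx', g', hg'⟩ := happ (min δ r) (lt_min hδ hr)
  have h1 : dist (g⁻¹ • y) x < r := by rwa [← dist_smul g, smul_inv_smul]
  have h2 : dist (g⁻¹ • y) ((g⁻¹ * g') • x') < min δ r := by
    rwa [mul_smul, dist_smul]
  have h3 := h2.trans_le (min_le_right _ _)
  have h4 : (g⁻¹ * g') • x' = x' := by
    refine hx'.2 _ ?_
    have := dist_triangle_left ((g⁻¹ * g') • x') x' (g⁻¹ • y)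
    have := dist_triangle (g⁻¹ • y) x x'
    have := dist_triangle_right x x' q
    have := hx.1
    have := hx'.1
    linarith
  rw [h4] at h2
  exact ⟨x', hx', h2.trans_le (min_le_left _ _)⟩

/-- A cover of the orbit space has a refinement whose order is controlled on the image of
`isolatedInOrbit G q r`: on this closed set, which embeds into `X`, use a refinement of the pulled
back cover of `X`, and keep the given cover on the complement. -/
theorem exists_refinement_on_isolatedInOrbit {n : ℕ} (hdim : topDim X ≤ n) (q : X) {r : ℝ}
    (hr : 0 < r) {ι : Type*} (U : ι → Set (Quotient (MulAction.orbitRel G X)))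
    (hU : ∀ i, IsOpen (U i)) (hcov : ⋃ i, U i = Set.univ) :
    ∃ P : ι → Set (Quotient (MulAction.orbitRel G X)), (∀ i, IsOpen (P i)) ∧
      ⋃ i, P i = Set.univ ∧ (∀ i, P i ⊆ U i) ∧
      ∀ z ∈ Quotient.mk (MulAction.orbitRel G X) '' isolatedInOrbit G q r,
        ∀ T : Finset ι, (∀ i ∈ T, z ∈ P i) → T.card ≤ n + 1 := by
  have hπ : IsOpenQuotientMap (Quotient.mk (MulAction.orbitRel G X)) :=
    MulAction.isOpenQuotientMap_quotientMk
  set π := Quotient.mk (MulAction.orbitRel G X) with hπdef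
  set D := isolatedInOrbit G q r with hD
  obtain ⟨V, hVo, hVc, hVU, hV⟩ := exists_precise_refinement_of_topDim_le hdim
    (fun i => π ⁻¹' U i) (fun i => (hU i).preimage hπ.continuous)
    (by rw [← Set.preimage_iUnion, hcov, Set.preimage_univ])
  have hπD : IsClosed (π '' D) := isClosed_mk_image_isolatedInOrbit q hr
  refine ⟨fun i => U i \ π '' D ∪ π '' (V i ∩ D), fun i => ?_, ?_, fun i => ?_, ?_⟩
  · rw [isOpen_iff_mem_nhds]
    rintro y (hy | ⟨x, ⟨hxV, hxD⟩, rfl⟩)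
    · exact Filter.mem_of_superset (((hU i).sdiff hπD).mem_nhds hy) Set.subset_union_left
    · obtain ⟨δ, hδ, hball⟩ := Metric.isOpen_iff.1 ((hVo i)) x hxV
      refine Filter.mem_of_superset (hπ.isOpenMap.image_mem_nhds
        (Metric.ball_mem_nhds x (lt_min hδ hr))) ?_
      rintro _ ⟨y, hy, rfl⟩
      rw [Metric.mem_ball, lt_min_iff] at hy
      by_cases hyD : π y ∈ π '' D
      · right
        obtain ⟨z, hz, hzy⟩ := hyD
        obtain ⟨g, rfl⟩ := orbitRel_mk_eq_iff.1 hzy.symm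
        have : g • z = z := by
          refine hz.2 g ?_
          have := dist_triangle (g • z) x z
          have := dist_triangle_right x z q
          have := hxD.1
          have := hz.1
          linarith
        rw [this] at hy ⊢
        exact ⟨z, ⟨hball hy.1, hz⟩, rfl⟩
      · exact Or.inl ⟨hVU i (hball hy.1), hyD⟩
  · refine Set.iUnion_eq_univ_iff.2 fun y => ?_
    by_cases hy : y ∈ π '' D
    · obtain ⟨x, hx, rfl⟩ := hy
      obtain ⟨i, hi⟩ := Set.iUnion_eq_univ_iff.1 hVc x
      exact ⟨i, Or.inr ⟨x, ⟨hi, hx⟩, rfl⟩⟩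
    · obtain ⟨i, hi⟩ := Set.iUnion_eq_univ_iff.1 hcov y
      exact ⟨i, Or.inl ⟨hi, hy⟩⟩
  · refine Set.union_subset Set.sdiff_subset ?_
    rintro _ ⟨x, ⟨hx, -⟩, rfl⟩
    exact hVU i hx
  · rintro _ ⟨x, hx, rfl⟩ T hT
    refine hV x T fun i hi => ?_
    rcases hT i hi with h | ⟨y, ⟨hyV, hyD⟩, hyx⟩
    · exact absurd ⟨x, hx, rfl⟩ h.2
    · obtain ⟨g, rfl⟩ := orbitRel_mk_eq_iff.1 hyx
      rwa [smul_eq_of_mem_isolatedInOrbit hr hx hyD] at hyV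

/-- Passing to the orbit space does not raise the covering dimension: locally finite open covers of
the orbit space have open refinements of order at most `n + 1`. -/
theorem exists_refinement_quotient_orbitRel [TopologicalSpace.SeparableSpace X]
    (hdisc : ∀ x : X, DiscreteTopology (MulAction.orbit G x)) {n : ℕ} (hdim : topDim X ≤ n)
    {ι : Type*} (U : ι → Set (Quotient (MulAction.orbitRel G X))) (hU : ∀ i, IsOpen (U i))
    (hcov : ⋃ i, U i = Set.univ) (hlf : LocallyFinite U) :
    ∃ W : ι → Set (Quotient (MulAction.orbitRel G X)), (∀ i, IsOpen (W i)) ∧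
      ⋃ i, W i = Set.univ ∧ (∀ i, W i ⊆ U i) ∧
      ∀ z, ∀ T : Finset ι, (∀ i ∈ T, z ∈ W i) → T.card ≤ n + 1 := by
  rcases isEmpty_or_nonempty X with hX | hX
  · exact ⟨U, hU, hcov, fun _ => subset_rfl, fun z => isEmptyElim z.out⟩
  have : SecondCountableTopology X := UniformSpace.secondCountable_of_separable X
  have : SecondCountableTopology (Quotient (MulAction.orbitRel G X)) :=
    ContinuousConstSMul.secondCountableTopology
  have : T3Space (Quotient (MulAction.orbitRel G X)) := t3Space_quotient_orbitRel hdisc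
  let C : ℕ → Set (Quotient (MulAction.orbitRel G X)) := fun k =>
    Quotient.mk _ '' isolatedInOrbit G (TopologicalSpace.denseSeq X k.unpair.1)
      (1 / ((k.unpair.2 : ℝ) + 1))
  have hC : ⋃ k, C k = Set.univ := by
    refine Set.iUnion_eq_univ_iff.2 fun y => ?_
    induction y using Quotient.inductionOn with | _ x
    obtain ⟨ε, hε, h⟩ := exists_pos_forall_smul_eq (hdisc x)
    obtain ⟨m, hm⟩ := exists_nat_one_div_lt (show 0 < ε / 4 by positivity)
    obtain ⟨l, hl⟩ := Metric.denseRange_iff.1 (TopologicalSpace.denseRange_denseSeq X) x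
      (1 / ((m : ℝ) + 1)) Nat.one_div_pos_of_nat
    refine ⟨Nat.pair l m, x, ?_, rfl⟩
    simp only [Nat.unpair_pair]
    exact ⟨hl.le, fun g hg => h g (by linarith)⟩
  obtain ⟨F, hF, hFc, hFU, hFn⟩ := exists_closed_refinement_of_forall_nat C hC
    (fun k U hU hcov => exists_refinement_on_isolatedInOrbit hdim _ Nat.one_div_pos_of_nat U hU hcov)
    U hU hcov hlf.point_finite
  let _ := TopologicalSpace.metrizableSpaceMetric (Quotient (MulAction.orbitRel G X))
  obtain ⟨W, hWo, hFW, hWU, hW⟩ := exists_open_swelling F U hF (hlf.subset hFU) hU hFU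
  refine ⟨W, hWo, ?_, hWU, fun z T hT => ?_⟩
  · exact Set.eq_univ_of_univ_subset (hFc ▸ Set.iUnion_mono hFW)
  · obtain ⟨y, hy⟩ := hW T ⟨z, hT⟩
    exact hFn y T hy

end IsometricAction

/-! ### Slices, the associated good open cover and the map to its nerve -/

/-- A family of open slices of a `G`-space `X`: open sets `sets i`, each invariant under the
stabilizer of a point `center i` and disjoint from its translates by all other group elements, such
that the translates of all of them cover `X`. -/
structure SliceFamily (G : Type v) (X : Type u) (ι : Type*) [Group G] [TopologicalSpace X]
    [MulAction G X] where
  sets : ι → Set X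
  center : ι → X
  isOpen : ∀ i, IsOpen (sets i)
  mem_stabilizer : ∀ i, ∀ g : G, (g • sets i ∩ sets i).Nonempty →
    g ∈ MulAction.stabilizer G (center i)
  smul_eq : ∀ i, ∀ g ∈ MulAction.stabilizer G (center i), g • sets i = sets i
  cover : ∀ y, ∃ i, ∃ g : G, y ∈ g • sets i

namespace SliceFamily

variable {G : Type v} {X : Type u} {ι : Type*} [Group G] [TopologicalSpace X] [MulAction G X]
  (S : SliceFamily G X ι)

theorem smul_eq_smul_of_mem {i : ι} {g h : G} {y : X} (hg : y ∈ g • S.sets i)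
    (hh : y ∈ h • S.sets i) : g • S.sets i = h • S.sets i := by
  have : (h⁻¹ * g) • S.sets i = S.sets i := by
    refine S.smul_eq i _ (S.mem_stabilizer i _ ⟨h⁻¹ • y, ?_, ?_⟩)
    · rw [mul_smul]
      exact Set.smul_mem_smul_set hg
    · exact Set.mem_smul_set_iff_inv_smul_mem.1 hh
  rw [mul_smul] at this
  exact inv_smul_eq_iff.1 this

/-- The translate of the `i`-th slice that contains `y`; empty if there is none. -/
def translateAt (i : ι) (y : X) : Set X :=
  ⋃ (g : G) (_ : y ∈ g • S.sets i), g • S.sets i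

theorem translateAt_eq {i : ι} {g : G} {y : X} (hg : y ∈ g • S.sets i) :
    S.translateAt i y = g • S.sets i := by
  refine Set.Subset.antisymm ?_ (Set.subset_iUnion₂_of_subset g hg subset_rfl)
  exact Set.iUnion₂_subset fun h hh => (S.smul_eq_smul_of_mem hh hg).subset

theorem mk_mem_image_iff {i : ι} {y : X} :
    Quotient.mk (MulAction.orbitRel G X) y ∈ Quotient.mk (MulAction.orbitRel G X) '' S.sets i ↔
      ∃ g : G, y ∈ g • S.sets i := by
  constructor
  · rintro ⟨x, hx, hxy⟩
    obtain ⟨g, rfl⟩ := orbitRel_mk_eq_iff.1 hxy.symm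
    exact ⟨g, Set.smul_mem_smul_set hx⟩
  · rintro ⟨g, x, hx, rfl⟩
    exact ⟨x, hx, (orbitRel_mk_smul g x).symm⟩

theorem mk_mem_image_of_mem_finsupport
    (ρ : PartitionOfUnity ι (Quotient (MulAction.orbitRel G X)))
    (hρ : ρ.IsSubordinate fun i => Quotient.mk (MulAction.orbitRel G X) '' S.sets i)
    {i : ι} {z : Quotient (MulAction.orbitRel G X)} (hi : i ∈ ρ.finsupport z) :
    z ∈ Quotient.mk (MulAction.orbitRel G X) '' S.sets i :=
  hρ i (subset_tsupport _ ((ρ.mem_finsupport z).1 hi))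

variable [ContinuousConstSMul G X]

/-- The good open cover by all translates of the nonempty slices. -/
def toGoodOpenCover : GoodOpenCover G X where
  sets := {A | A.Nonempty ∧ ∃ i, ∃ g : G, A = g • S.sets i}
  isOpenCovering :=
    { isOpen := by
        rintro _ ⟨-, i, g, rfl⟩
        exact (S.isOpen i).smul g
      sUnion_eq := by
        refine Set.eq_univ_of_forall fun y => ?_
        obtain ⟨i, g, h⟩ := S.cover y
        exact ⟨_, ⟨⟨y, h⟩, i, g, rfl⟩, h⟩ }
  smul_mem := by
    rintro h _ ⟨hne, i, g, rfl⟩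
    exact ⟨hne.smul_set, i, h * g, (mul_smul h g _).symm⟩
  good := by
    rintro _ ⟨hne, i, g, rfl⟩
    have h1 : ∀ h : G, (h • g • S.sets i ∩ g • S.sets i).Nonempty → h • g • S.sets i =
        g • S.sets i := by
      rintro h ⟨y, hy, hy'⟩
      rw [← mul_smul] at hy ⊢
      exact S.smul_eq_smul_of_mem hy hy'
    have h2 : ∀ h : G, h • g • S.sets i = g • S.sets i ↔
        h ∈ MulAction.stabilizer G (g • S.center i) := by
      intro h
      have h3 : h • g • S.sets i = g • S.sets i ↔ (g⁻¹ * h * g) • S.sets i = S.sets i := by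
        rw [mul_smul, mul_smul, inv_smul_eq_iff]
      have h4 : h ∈ MulAction.stabilizer G (g • S.center i) ↔
          g⁻¹ * h * g ∈ MulAction.stabilizer G (S.center i) := by
        rw [MulAction.mem_stabilizer_iff, MulAction.mem_stabilizer_iff, mul_smul, mul_smul,
          inv_smul_eq_iff]
      rw [h3, h4]
      refine ⟨fun h => S.mem_stabilizer i _ ?_, S.smul_eq i _⟩
      rw [h, Set.inter_self]
      exact Set.smul_set_nonempty.1 hne
    refine ⟨g • S.center i, fun h => ⟨⟨h1 h, fun h' => ?_⟩, h2 h⟩⟩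
    rwa [h', Set.inter_self]

theorem translateAt_mem {i : ι} {y : X}
    (hy : Quotient.mk (MulAction.orbitRel G X) y ∈ Quotient.mk _ '' S.sets i) :
    y ∈ S.translateAt i y ∧ S.translateAt i y ∈ S.toGoodOpenCover.sets := by
  obtain ⟨g, hg⟩ := S.mk_mem_image_iff.1 hy
  rw [S.translateAt_eq hg]
  exact ⟨hg, ⟨y, hg⟩, i, g, rfl⟩

/-- Distinct members of a simplex of the nerve come from distinct slices, so the order of the
images of the slices in the orbit space bounds the dimension of the nerve. -/
theorem card_le_of_mem_faces {n : ℕ}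
    (hn : ∀ z, ∀ T : Finset ι,
      (∀ i ∈ T, z ∈ Quotient.mk (MulAction.orbitRel G X) '' S.sets i) → T.card ≤ n + 1)
    {s : Finset (Set X)} (hs : s ∈ (nerve S.toGoodOpenCover.sets).faces) : s.card ≤ n + 1 := by
  classical
  obtain ⟨hne, hsub, y, hy⟩ := hs
  have hidx : ∀ A ∈ s, ∃ i, ∃ g : G, A = g • S.sets i := fun A hA => (hsub hA).2
  obtain ⟨A₀, hA₀⟩ := hne
  have : Nonempty ι := ⟨(hidx A₀ hA₀).choose⟩
  choose! idx g hidx using hidx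
  have hinj : Set.InjOn idx s := by
    intro A hA B hB hAB
    have h1 := hy A hA
    have h2 := hy B hB
    rw [hidx A hA] at h1
    rw [hidx B hB, ← hAB] at h2
    rw [hidx A hA, hidx B hB, ← hAB]
    exact S.smul_eq_smul_of_mem h1 h2
  rw [← Finset.card_image_of_injOn hinj]
  refine hn (Quotient.mk _ y) _ fun i hi => ?_
  obtain ⟨A, hA, rfl⟩ := Finset.mem_image.1 hi
  refine S.mk_mem_image_iff.2 ⟨g A, ?_⟩
  rw [← hidx A hA]
  exact hy A hA

section nerveMap

variable (ρ : PartitionOfUnity ι (Quotient (MulAction.orbitRel G X)))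
  (hρ : ρ.IsSubordinate fun i => Quotient.mk (MulAction.orbitRel G X) '' S.sets i)

/-- The map to the nerve given by a partition of unity on the orbit space subordinate to the images
of the slices: the `i`-th function is the weight of the translate of the `i`-th slice containing the
point. -/
noncomputable def nerveMap (y : X) : S.toGoodOpenCover.Nerve := by
  let z := Quotient.mk (MulAction.orbitRel G X) y
  let w : Set X →₀ ℝ := ∑ i ∈ ρ.finsupport z, Finsupp.single (S.translateAt i y) (ρ i z)
  have hsum : ∑ A ∈ w.support, w A = 1 := by
    change w.degree = 1
    rw [map_sum]
    simp only [Finsupp.degree_single]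
    exact ρ.sum_finsupport (Set.mem_univ z)
  have hsupp : ∀ A ∈ w.support, y ∈ A ∧ A ∈ S.toGoodOpenCover.sets := by
    classical
    intro A hA
    obtain ⟨i, hi, hA'⟩ := Finset.mem_biUnion.1 (Finsupp.support_finsetSum hA)
    rw [Finset.mem_singleton.1 (Finsupp.support_single_subset hA')]
    exact S.translateAt_mem (S.mk_mem_image_of_mem_finsupport ρ hρ hi)
  exact
  { weight := w
    nonneg := fun A => by
      rw [Finsupp.finsetSum_apply]
      refine Finset.sum_nonneg fun i _ => ?_
      rw [Finsupp.single_apply]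
      split_ifs
      exacts [ρ.nonneg i z, le_rfl]
    sum_eq_one := hsum
    support_mem := by
      refine ⟨?_, fun A hA => (hsupp A hA).2, y, fun A hA => (hsupp A hA).1⟩
      rw [Finset.nonempty_iff_ne_empty]
      intro h
      rw [h, Finset.sum_empty] at hsum
      exact zero_ne_one hsum }

theorem nerveMap_weight (y : X) : (S.nerveMap ρ hρ y).weight =
    ∑ i ∈ ρ.finsupport (Quotient.mk (MulAction.orbitRel G X) y),
      Finsupp.single (S.translateAt i y) (ρ i (Quotient.mk (MulAction.orbitRel G X) y)) :=
  rfl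

theorem nerveMap_smul (g : G) (y : X) : S.nerveMap ρ hρ (g • y) = g • S.nerveMap ρ hρ y := by
  classical
  refine Realization.ext (Finsupp.ext fun A => ?_)
  rw [GoodOpenCover.smul_weight, nerveMap_weight, nerveMap_weight, orbitRel_mk_smul,
    Finsupp.finsetSum_apply, Finsupp.finsetSum_apply]
  refine Finset.sum_congr rfl fun i hi => ?_
  obtain ⟨h, hh⟩ := S.mk_mem_image_iff.1 (S.mk_mem_image_of_mem_finsupport ρ hρ hi)
  have hgh : g • y ∈ (g * h) • S.sets i := by
    rw [mul_smul]
    exact Set.smul_mem_smul_set hh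
  rw [S.translateAt_eq hh, S.translateAt_eq hgh, mul_smul, Finsupp.single_apply,
    Finsupp.single_apply]
  simp only [smul_eq_iff_eq_inv_smul]

theorem continuous_nerveMap : Continuous (S.nerveMap ρ hρ) := by
  classical
  have hπ : IsOpenQuotientMap (Quotient.mk (MulAction.orbitRel G X)) :=
    MulAction.isOpenQuotientMap_quotientMk
  refine continuous_iff_continuousAt.2 fun y₀ => ?_
  obtain ⟨I, N, hN, hNI, hsupp⟩ := ρ.exists_finset_nhds_support_subset hρ
    (fun i => hπ.isOpenMap _ (S.isOpen i)) (Quotient.mk _ y₀)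
  have hI : ∀ i ∈ I, ∃ g : G, y₀ ∈ g • S.sets i := fun i hi =>
    S.mk_mem_image_iff.1 (Set.mem_iInter₂.1 (hNI (mem_of_mem_nhds hN)) i hi)
  -- Near `y₀` only the slices indexed by `I` matter, and for these the translate is constant.
  set M : Set X := Quotient.mk _ ⁻¹' N ∩ ⋂ i ∈ I, S.translateAt i y₀ with hM
  have hMnhds : M ∈ nhds y₀ := by
    refine Filter.inter_mem (hπ.continuous.continuousAt hN) ?_
    refine (Filter.biInter_finset_mem I).2 fun i hi => ?_
    obtain ⟨g, hg⟩ := hI i hi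
    rw [S.translateAt_eq hg]
    exact ((S.isOpen i).smul g).mem_nhds hg
  have htrans : ∀ y ∈ M, ∀ i ∈ I, S.translateAt i y = S.translateAt i y₀ := by
    intro y hy i hi
    obtain ⟨g, hg⟩ := hI i hi
    have := Set.mem_iInter₂.1 hy.2 i hi
    rw [S.translateAt_eq hg] at this ⊢
    exact S.translateAt_eq this
  have hweight : ∀ y ∈ M, (S.nerveMap ρ hρ y).weight =
      ∑ i ∈ I, Finsupp.single (S.translateAt i y₀) (ρ i (Quotient.mk _ y)) := by
    intro y hy
    have hsub : ρ.finsupport (Quotient.mk (MulAction.orbitRel G X) y) ⊆ I := by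
      rw [← Finset.coe_subset, ρ.coe_finsupport]
      exact hsupp _ hy.1
    rw [nerveMap_weight, Finset.sum_subset hsub]
    · exact Finset.sum_congr rfl fun i hi => by rw [htrans y hy i hi]
    · intro i _ hi
      rw [ρ.mem_finsupport, Function.notMem_support] at hi
      rw [hi, Finsupp.single_zero]
  have hface : ∀ y ∈ M, (S.nerveMap ρ hρ y).weight.support ⊆ I.image (S.translateAt · y₀) := by
    intro y hy A hA
    rw [hweight y hy] at hA
    obtain ⟨i, hi, hA'⟩ := Finset.mem_biUnion.1 (Finsupp.support_finsetSum hA)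
    rw [Finset.mem_singleton.1 (Finsupp.support_single_subset hA')]
    exact Finset.mem_image_of_mem _ hi
  have hmem : ∀ A ∈ I.image (S.translateAt · y₀), y₀ ∈ A ∧ A ∈ S.toGoodOpenCover.sets := by
    intro A hA
    obtain ⟨i, hi, rfl⟩ := Finset.mem_image.1 hA
    exact S.translateAt_mem (S.mk_mem_image_iff.2 (hI i hi))
  have hs : I.image (S.translateAt · y₀) ∈ (nerve S.toGoodOpenCover.sets).faces :=
    ⟨(S.nerveMap ρ hρ y₀).support_mem.1.mono (hface y₀ (mem_of_mem_nhds hMnhds)),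
      fun A hA => (hmem A hA).2, y₀, fun A hA => (hmem A hA).1⟩
  refine (Realization.continuousOn_of_weight hs hface fun A => ?_).continuousAt hMnhds
  have hcont : Continuous fun y : X => ∑ i ∈ I,
      if S.translateAt i y₀ = A then ρ i (Quotient.mk (MulAction.orbitRel G X) y) else 0 := by
    refine continuous_finsetSum _ fun i _ => ?_
    split_ifs
    exacts [(ρ i).continuous.comp hπ.continuous, continuous_const]
  refine hcont.continuousOn.congr fun y hy => ?_
  simp only [hweight y hy, Finsupp.finsetSum_apply, Finsupp.single_apply]

end nerveMap

end SliceFamily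

/-- Intersecting small balls around points with the preimages of a cover of the orbit space gives
slices with prescribed images in the orbit space. -/
theorem exists_sliceFamily {G : Type v} {X : Type u} [Group G] [MetricSpace X] [MulAction G X]
    [IsIsometricSMul G X] {r : X → ℝ}
    (hr : ∀ (x : X) (g : G), dist (g • x) x < 2 * r x → g • x = x)
    (W : X → Set (Quotient (MulAction.orbitRel G X))) (hW : ∀ x, IsOpen (W x))
    (hcov : ⋃ x, W x = Set.univ) (hWr : ∀ x, W x ⊆ Quotient.mk _ '' Metric.ball x (r x)) :
    ∃ S : SliceFamily G X X, ∀ x, Quotient.mk (MulAction.orbitRel G X) '' S.sets x = W x := by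
  have hπ : IsOpenQuotientMap (Quotient.mk (MulAction.orbitRel G X)) :=
    MulAction.isOpenQuotientMap_quotientMk
  have himage : ∀ x, Quotient.mk (MulAction.orbitRel G X) ''
      (Quotient.mk _ ⁻¹' W x ∩ Metric.ball x (r x)) = W x := by
    intro x
    rw [Set.inter_comm, Set.image_inter_preimage, Set.inter_eq_right]
    exact hWr x
  refine ⟨
    { sets := fun x => Quotient.mk _ ⁻¹' W x ∩ Metric.ball x (r x)
      center := id
      isOpen := fun x => ((hW x).preimage hπ.continuous).inter Metric.isOpen_ball
      mem_stabilizer := ?_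
      smul_eq := ?_
      cover := ?_ }, himage⟩
  · rintro x g ⟨_, ⟨y, hy, rfl⟩, hgy⟩
    refine hr x g ?_
    have h1 := Metric.mem_ball.1 hy.2
    have h2 := Metric.mem_ball.1 hgy.2
    have h3 := dist_triangle_left (g • x) x (g • y)
    rw [dist_smul] at h3
    simp only at h2
    linarith
  · intro x g hg
    have hg' : g • x = x := hg
    have hpre : g • (Quotient.mk (MulAction.orbitRel G X) ⁻¹' W x) =
        Quotient.mk (MulAction.orbitRel G X) ⁻¹' W x := by
      ext y
      rw [Set.mem_smul_set_iff_inv_smul_mem, Set.mem_preimage, Set.mem_preimage, orbitRel_mk_smul]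
    rw [Set.smul_set_inter, hpre, Metric.smul_ball, hg']
  · intro y
    obtain ⟨x, hx⟩ := Set.iUnion_eq_univ_iff.1 hcov (Quotient.mk _ y)
    rw [← himage x] at hx
    obtain ⟨z, hz, hzy⟩ := hx
    obtain ⟨g, rfl⟩ := orbitRel_mk_eq_iff.1 hzy.symm
    exact ⟨x, g, Set.smul_mem_smul_set hz⟩

/-! ### Existence of a good open cover with an equivariant map to its nerve -/

theorem mainTheorem3 {G : Type v} {X : Type u} [Group G] [MetricSpace X]
    [TopologicalSpace.SeparableSpace X] [MulAction G X] [IsIsometricSMul G X]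
    (hdisc : ∀ x : X, DiscreteTopology (MulAction.orbit G x))
    (n : ℕ) (hdim : topDim X ≤ n) :
    ∃ (𝒱 : GoodOpenCover G X) (Y : GCWComplex G 𝒱.Nerve),
      (∀ d : ℕ, Y.openCells d =
        {e | ∃ s ∈ (nerve 𝒱.sets).faces, s.card = d + 1 ∧
          e = Realization.openSimplex (nerve 𝒱.sets) s}) ∧
      Y.DimLE n ∧
      (∀ y : 𝒱.Nerve, ∃ x : X, MulAction.stabilizer G y ≤ MulAction.stabilizer G x) ∧
      ∃ f : C(X, 𝒱.Nerve), ∀ (g : G) (x : X), f (g • x) = g • f x := by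
  have hπ : IsOpenQuotientMap (Quotient.mk (MulAction.orbitRel G X)) :=
    MulAction.isOpenQuotientMap_quotientMk
  have : SecondCountableTopology X := UniformSpace.secondCountable_of_separable X
  have : SecondCountableTopology (Quotient (MulAction.orbitRel G X)) :=
    ContinuousConstSMul.secondCountableTopology
  have : T3Space (Quotient (MulAction.orbitRel G X)) := t3Space_quotient_orbitRel hdisc
  let _ := TopologicalSpace.metrizableSpaceMetric (Quotient (MulAction.orbitRel G X))
  have hr : ∀ x : X, ∃ r > 0, ∀ g : G, dist (g • x) x < 2 * r → g • x = x := by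
    intro x
    obtain ⟨ε, hε, h⟩ := exists_pos_forall_smul_eq (hdisc x)
    exact ⟨ε / 2, half_pos hε, fun g hg => h g (by linarith)⟩
  choose r hr0 hr using hr
  obtain ⟨U, hU, hUc, hUlf, hUr⟩ := precise_refinement
    (fun x : X => Quotient.mk (MulAction.orbitRel G X) '' Metric.ball x (r x))
    (fun x => hπ.isOpenMap _ Metric.isOpen_ball) (Set.iUnion_eq_univ_iff.2 fun z => by
      obtain ⟨x, rfl⟩ := hπ.surjective z
      exact ⟨x, x, Metric.mem_ball_self (hr0 x), rfl⟩)
  obtain ⟨W, hW, hWc, hWU, hWn⟩ := exists_refinement_quotient_orbitRel hdisc hdim U hU hUc hUlf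
  obtain ⟨S, hS⟩ := exists_sliceFamily hr W hW hWc fun x => (hWU x).trans (hUr x)
  obtain ⟨ρ, hρ⟩ := PartitionOfUnity.exists_isSubordinate isClosed_univ W hW hWc.ge
  have hρ' : ρ.IsSubordinate fun x => Quotient.mk (MulAction.orbitRel G X) '' S.sets x := by
    simpa only [hS] using hρ
  refine ⟨S.toGoodOpenCover, S.toGoodOpenCover.nerveGCWComplex,
    S.toGoodOpenCover.nerveGCWComplex_openCells,
    S.toGoodOpenCover.nerveGCWComplex_dimLE fun s hs => S.card_le_of_mem_faces ?_ hs,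
    S.toGoodOpenCover.stabilizer_nerve_le,
    ⟨S.nerveMap ρ hρ', S.continuous_nerveMap ρ hρ'⟩, S.nerveMap_smul ρ hρ'⟩
  simpa only [hS] using hWn
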